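/- Let $A$ and $B$ be bounded operators on a complex Hilbert space $H$, with $A$ normal and $\|B\|=1$. For bounded operators $T_1,\dots,T_k$ on $H$ the proper projective joint spectrum is $$\sigma_p(T_1,\dots,T_k)=\{x\in\mathbb C^k:\ x_1T_1+\cdots+x_kT_k-I\ \text{is not invertible}\}.$$ A point $x\in\sigma_p(T_1,\dots,T_k)$ is said to have multiplicity $m$ if $1$ is an isolated point of the spectrum of $T(x)=x_1T_1+\cdots+x_kT_k$ and the Riesz projection $\frac1{2\pi i}\oint_{|w-1|=\rho}(w-T(x))^{-1}\,dw$ has rank $m$, where $\rho>0$ is so small that $1$ is the only point of the spectrum of $T(x)$ in $\{|w-1|\le\rho\}$. Let $\Delta_3(\tau,\epsilon)=\{w\in\mathbb C^3:\ |w_i-\tau_i|<\epsilon,\ i=1,2,3\}$. Let $n\ge 1$ be an integer and put $\tau_{1j}=(e^{2\pi ij/n},0,0)$, $\tau_{2j}=(0,e^{2\pi ij/n},0)$ for $j=0,\dots,n-1$. Suppose that there is an $\epsilon>0$ such that for $m=1,2$ and $j=0,\dots,n-1$: a) $\sigma_p(A,B,AB)\cap\Delta_3(\tau_{mj},\epsilon)=\{(x,y,z)\in\mathbb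 C^3:\ x^n+y^n+(-1)^{n-1}z^n=1\}\cap\Delta_3(\tau_{mj},\epsilon)$; b) every point of $\sigma_p(A,B,AB)\cap\Delta_3(\tau_{mj},\epsilon)$ has multiplicity one. Then the linear span $L$ of the eigenvectors of $A$ with eigenvalues $e^{2\pi im/n}$, $m=0,\dots,n-1$, has dimension $n$, and 1) $L$ is invariant under $B$; 2) the restriction of $B$ to $L$ is a unitary operator of $L$, and so is the restriction of $A$ to $L$. -/

import Mathlib

noncomputable section

/-- The linear pencil `x₁ T₁ + ... + xₖ Tₖ` of a tuple of bounded operators. -/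
def pencil {H : Type*} [NormedAddCommGroup H] [InnerProductSpace ℂ H] {k : ℕ}
    (T : Fin k → H →L[ℂ] H) (x : Fin k → ℂ) : H →L[ℂ] H :=
  ∑ i, x i • T i

/-- The proper projective joint spectrum `σ_p(T₁, ..., Tₖ) ⊆ ℂᵏ`: the points `x` for which
`x₁ T₁ + ... + xₖ Tₖ - I` is not invertible. -/
def properJointSpectrum {H : Type*} [NormedAddCommGroup H] [InnerProductSpace ℂ H] {k : ℕ}
    (T : Fin k → H →L[ℂ] H) : Set (Fin k → ℂ) :=
  {x | ¬ IsUnit (pencil T x - 1)}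

/-- The open polydisk of radius `r` centered at `c` in `ℂᵏ`. -/
def polydisk {k : ℕ} (c : Fin k → ℂ) (r : ℝ) : Set (Fin k → ℂ) :=
  {w | ∀ j, ‖w j - c j‖ < r}

/-- The Riesz integral `(2πi)⁻¹ ∮_{|w - c| = r} (w - S)⁻¹ dw`. -/
def rieszProjection {H : Type*} [NormedAddCommGroup H] [InnerProductSpace ℂ H]
    (S : H →L[ℂ] H) (c : ℂ) (r : ℝ) : H →L[ℂ] H :=
  (2 * (Real.pi : ℂ) * Complex.I)⁻¹ • ∮ w in C(c, r), resolvent S w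

/-- `c` is an isolated point of the spectrum of `S`, of algebraic multiplicity `m`: the Riesz
projection of `S` over a circle that separates `c` from the rest of the spectrum has rank `m`
(it does not depend on the choice of such a circle). -/
def IsIsolatedSpectralPointOfMultiplicity {H : Type*} [NormedAddCommGroup H]
    [InnerProductSpace ℂ H] (S : H →L[ℂ] H) (c : ℂ) (m : ℕ) : Prop :=
  ∃ r : ℝ, 0 < r ∧ spectrum ℂ S ∩ Metric.closedBall c r = {c} ∧
    LinearMap.rank (rieszProjection S c r : H →ₗ[ℂ] H) = (m : Cardinal)

/-- The point `x` of the proper joint spectrum of `T₁, ..., Tₖ` has multiplicity `m`: one is an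
isolated spectral point, of multiplicity `m`, of the pencil `x₁ T₁ + ... + xₖ Tₖ`. -/
def HasMultiplicityAt {H : Type*} [NormedAddCommGroup H] [InnerProductSpace ℂ H] {k : ℕ}
    (T : Fin k → H →L[ℂ] H) (x : Fin k → ℂ) (m : ℕ) : Prop :=
  IsIsolatedSpectralPointOfMultiplicity (pencil T x) 1 m

/-- The Fourier surface `xⁿ + yⁿ + (-1)ⁿ⁻¹ zⁿ = 1` in `ℂ³` (used for `n ≥ 1`). -/
def fourierSurface (n : ℕ) : Set (Fin 3 → ℂ) :=
  {x | x 0 ^ n + x 1 ^ n + (-1) ^ (n - 1) * x 2 ^ n = 1}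

/-- The `n`-th root of unity `e^{2πij/n}`. -/
def unityRoot (n j : ℕ) : ℂ :=
  Complex.exp (2 * Real.pi * Complex.I * j / n)

/-- The linear span of the eigenvectors of `A` with eigenvalues `e^{2πim/n}`, `0 ≤ m < n`. -/
def rootEigenspan {H : Type*} [NormedAddCommGroup H] [InnerProductSpace ℂ H]
    (A : H →L[ℂ] H) (n : ℕ) : Submodule ℂ H :=
  Submodule.span ℂ
    {v | ∃ m < n, Module.End.HasEigenvector (A : Module.End ℂ H) (unityRoot n m) v}

/-- `L` is invariant under `S` and the restriction of `S` to `L` is a unitary operator of `L`. -/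
def RestrictsToUnitary {H : Type*} [NormedAddCommGroup H] [InnerProductSpace ℂ H]
    (S : H →L[ℂ] H) (L : Submodule ℂ H) : Prop :=
  ∃ U : L ≃ₗᵢ[ℂ] L, ∀ v : L, (U v : H) = S v

end

open Filter Topology

/-! Let `lam ^ n = 1` and let `e` be the unit eigenvector with `lam • A e = e`. On the line x =
`lam`, y = u, z = -`lam` u the pencil minus the identity is (`lam` A - 1)(1 - uB). Moving along the
surface with z fixed, non-invertibility to first order forces ⟨e, B(1 - uB)⁻¹e⟩ = uⁿ⁻¹⟨e, (1 -
uB)⁻¹e⟩ (`inner_apply_inverse_one_sub_smul`). Comparing coefficients of u gives ⟨e, Bⁿe⟩ = 1, and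
since B is a contraction, Bⁿe = e (`pow_apply_eq_self_of_inner_inverse`).

Hence each `e` is a sum of eigenvectors of B for n-th roots of unity (`mem_of_pow_apply_eq_self`).
Multiplicity one at the points (0, root, 0) makes these eigenspaces at most one-dimensional, so
together they span at most n dimensions. The n independent vectors `e` therefore span the same
space, which is thus B-invariant; B is isometric there because B*B fixes every vector on which a
contraction preserves the norm. -/

/-- An invertibility criterion from first-order perturbation theory. -/
theorem eventually_isUnit_add_of_hasDerivAt {R : Type*} [NormedRing R] [NormedAlgebra ℂ R]
    [CompleteSpace R] {K P X : R} {c : ℂ} {E : ℂ → R} (hP : P * P = P) (hPK : P * K = 0)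
    (hKP : K * P = 0) (hK : IsUnit (K + P)) (hX : P * X * P = c • P) (hc : c ≠ 0)
    (hE : HasDerivAt E X 0) (hE0 : E 0 = 0) :
    ∀ᶠ δ in 𝓝[≠] (0 : ℂ), IsUnit (K + E δ) := by
  have hPi : ∀ a : ℂ, a ≠ 0 → IsUnit (1 - P + a • P) := by
    intro a ha
    refine isUnit_iff_exists.2 ⟨1 - P + a⁻¹ • P, ?_, ?_⟩ <;>
    · simp only [mul_add, add_mul, mul_sub, sub_mul, mul_one, one_mul, smul_mul_assoc,
        mul_smul_comm, hP]
      simp [ha]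
  have hlim : IsUnit (K + P * X) := by
    obtain ⟨N, hN⟩ : ∃ N, N = P * X - c • P := ⟨_, rfl⟩
    have hPN : P * N = N := by rw [hN, mul_sub, ← mul_assoc, hP, mul_smul_comm, hP]
    have hNP : N * P = 0 := by rw [hN, sub_mul, hX, smul_mul_assoc, hP, sub_self]
    have hNN : N * N = 0 := by rw [← hPN, ← mul_assoc, mul_assoc P, hNP]; simp
    have hKN : K * N = 0 := by rw [← hPN, ← mul_assoc, hKP, zero_mul]
    have h1 : IsUnit (1 + c⁻¹ • N) := by
      refine isUnit_iff_exists.2 ⟨1 - c⁻¹ • N, ?_, ?_⟩ <;>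
      simp [mul_add, add_mul, mul_sub, sub_mul, hNN]
    -- In block form relative to `P` the limit is triangular, with corner `c`; `N` is its
    -- square-zero off-diagonal part.
    have h3 : K + P * X = (K + P) * ((1 - P + c • P) * (1 + c⁻¹ • N)) := by
      have : P * X = N + c • P := by rw [hN, sub_add_cancel]
      rw [this]
      simp [mul_add, add_mul, mul_sub, sub_mul, hPN, hKN, hP, hKP, smul_smul, hc]
      abel
    rw [h3]
    exact hK.mul ((hPi c hc).mul h1)
  have hS := hasDerivAt_iff_tendsto_slope.1 hE
  have ht : Tendsto (fun δ : ℂ => K + δ • ((1 - P) * slope E 0 δ) + P * slope E 0 δ) (𝓝[≠] 0)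
      (𝓝 (K + (0 : ℂ) • ((1 - P) * X) + P * X)) := by
    have h0 : Tendsto (fun δ : ℂ => δ) (𝓝[≠] 0) (𝓝 0) := tendsto_id.mono_left nhdsWithin_le_nhds
    exact (tendsto_const_nhds.add (h0.smul (hS.const_mul _))).add (hS.const_mul _)
  rw [zero_smul, add_zero] at ht
  filter_upwards [ht.eventually (Units.isOpen.mem_nhds hlim), self_mem_nhdsWithin] with δ h1 h2
  have h2 : δ ≠ 0 := h2
  have hEδ : E δ = δ • slope E 0 δ := by simp [slope_def_module, hE0, smul_smul, h2]
  -- Rescaling the range of `P` by `δ⁻¹` turns the degenerating family into one with the invertible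
  -- limit `K + P * X`.
  have h4 : (1 - P + δ⁻¹ • P) * (K + E δ) = K + δ • ((1 - P) * slope E 0 δ) + P * slope E 0 δ := by
    rw [hEδ]
    simp [mul_add, add_mul, sub_mul, hPK, smul_smul, h2, smul_sub, add_assoc]
  obtain ⟨u, hu⟩ := hPi δ⁻¹ (inv_ne_zero h2)
  rw [← hu] at h4
  have h5 := h1
  change IsUnit _ at h5
  rwa [← h4, Units.isUnit_units_mul] at h5

/-! ### Riesz projections and simple spectral points -/

section
variable {H : Type*} [NormedAddCommGroup H] [InnerProductSpace ℂ H] [CompleteSpace H]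

theorem rieszProjection_apply_of_apply_eq_self {S : H →L[ℂ] H} {r : ℝ} (hr : 0 < r)
    (hS : spectrum ℂ S ∩ Metric.closedBall 1 r = {1}) {v : H} (hv : S v = v) :
    rieszProjection S 1 r v = v := by
  have hres : ∀ w ∈ Metric.sphere (1 : ℂ) r, w ∈ resolventSet ℂ S := by
    intro w hw
    by_contra h
    have : w ∈ ({1} : Set ℂ) := hS ▸ ⟨h, Metric.sphere_subset_closedBall hw⟩
    rw [Set.mem_singleton_iff] at this
    simp [this, hr.ne] at hw
  have hint : CircleIntegrable (resolvent S) 1 r :=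
    ContinuousOn.circleIntegrable hr.le fun w hw =>
      (spectrum.hasDerivAt_resolvent_const_left (hres w hw)).continuousAt.continuousWithinAt
  have hap : (∮ w in C(1, r), resolvent S w) v = ∮ w in C(1, r), resolvent S w v := by
    unfold circleIntegral
    rw [ContinuousLinearMap.intervalIntegral_apply hint.out]
    simp
  have hval : ∀ w ∈ Metric.sphere (1 : ℂ) r, resolvent S w v = (w - 1)⁻¹ • v := by
    intro w hw
    have hw1 : w - 1 ≠ 0 := by
      rw [sub_ne_zero]; rintro rfl; simp [hr.ne] at hw
    have h1 : (algebraMap ℂ (H →L[ℂ] H) w - S) ((w - 1)⁻¹ • v) = v := by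
      have h3 : (algebraMap ℂ (H →L[ℂ] H) w - S) v = (w - 1) • v := by
        simp [Algebra.algebraMap_eq_smul_one, hv, sub_smul]
      rw [map_smul, h3, smul_smul, inv_mul_cancel₀ hw1, one_smul]
    have h2 : resolvent S w * (algebraMap ℂ (H →L[ℂ] H) w - S) = 1 :=
      Ring.inverse_mul_cancel _ (hres w hw)
    calc _ = resolvent S w ((algebraMap ℂ (H →L[ℂ] H) w - S) ((w - 1)⁻¹ • v)) := by rw [h1]
      _ = (resolvent S w * (algebraMap ℂ (H →L[ℂ] H) w - S)) ((w - 1)⁻¹ • v) := rfl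
      _ = _ := by rw [h2]; rfl
  rw [rieszProjection, smul_apply, hap,
    circleIntegral.integral_congr hr.le hval, circleIntegral.integral_smul_const,
    circleIntegral.integral_sub_center_inv _ hr.ne', smul_smul, inv_mul_cancel₀, one_smul]
  simp [Real.pi_ne_zero]

/-- The Riesz projection fixes every eigenvector for 1, so the eigenspace lies in its
one-dimensional range. -/
theorem IsIsolatedSpectralPointOfMultiplicity.exists_eq_smul {S : H →L[ℂ] H}
    (hS : IsIsolatedSpectralPointOfMultiplicity S 1 1) {v w : H} (hv : S v = v) (hv0 : v ≠ 0)
    (hw : S w = w) : ∃ a : ℂ, w = a • v := by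
  obtain ⟨r, hr, hsp, hrank⟩ := hS
  have hmem : ∀ x, S x = x → x ∈ (rieszProjection S 1 r : H →ₗ[ℂ] H).range := fun x hx =>
    ⟨x, rieszProjection_apply_of_apply_eq_self hr hsp hx⟩
  have h1 : Module.finrank ℂ (rieszProjection S 1 r : H →ₗ[ℂ] H).range = 1 := by
    rw [LinearMap.rank] at hrank
    exact Module.finrank_eq_of_rank_eq (by simpa using hrank)
  obtain ⟨a, ha⟩ := exists_smul_eq_of_finrank_eq_one h1
    (x := ⟨v, hmem v hv⟩) (by simpa using hv0) ⟨w, hmem w hw⟩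
  exact ⟨a, by simpa using (congrArg Subtype.val ha).symm⟩

/-- A simple isolated spectral point `1` of a normal operator comes from a unit vector spanning the
eigenspace, whose orthogonal projection is the spectral projection. -/
theorem exists_eigenvector_of_isStarNormal {T : H →L[ℂ] H} (hT : IsStarNormal T)
    (hS : IsIsolatedSpectralPointOfMultiplicity T 1 1) :
    ∃ e : H, ‖e‖ = 1 ∧ T e = e ∧ (∀ v, inner ℂ e (T v) = inner ℂ e v) ∧
      IsUnit (T - 1 + InnerProductSpace.rankOne ℂ e e) := by
  classical
  obtain ⟨r, hr, hsp, -⟩ := id hS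
  have h1 : (1 : ℂ) ∈ spectrum ℂ T := (hsp.ge (Set.mem_singleton 1)).1
  -- The indicator of {1} is continuous on the spectrum because 1 is isolated there, so the
  -- functional calculus yields the spectral projection.
  set f : ℂ → ℂ := fun w => if w = 1 then 1 else 0 with hf
  have hfc : ContinuousOn f (spectrum ℂ T) := by
    intro w hw
    by_cases hw1 : w = 1
    · have : f =ᶠ[𝓝[spectrum ℂ T] w] fun _ => 1 := by
        filter_upwards [self_mem_nhdsWithin,
          nhdsWithin_le_nhds (Metric.closedBall_mem_nhds w hr)] with x hx hx'
        have : x ∈ ({1} : Set ℂ) := hsp ▸ ⟨hx, hw1 ▸ hx'⟩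
        simpa [hf] using this
      exact continuousWithinAt_const.congr_of_eventuallyEq this (by simp [hf, hw1])
    · have : f =ᶠ[𝓝[spectrum ℂ T] w] fun _ => 0 := by
        filter_upwards [nhdsWithin_le_nhds (isOpen_ne.mem_nhds hw1)] with x hx
        simpa [hf] using hx
      exact continuousWithinAt_const.congr_of_eventuallyEq this (by simp [hf, hw1])
  set P := cfc f T with hPdef
  have hff : cfc (fun w => f w * w) T = P := cfc_congr fun w _ => by
    by_cases hw : w = 1 <;> simp [hf, hw]
  have hPT : P * T = P := by
    rw [cfc_mul f (fun w => w) T hfc, cfc_id' ℂ T] at hff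
    exact hff
  have hTP : T * P = P := by
    simp_rw [mul_comm (f _)] at hff
    rw [cfc_mul (fun w => w) f T continuousOn_id hfc, cfc_id' ℂ T] at hff
    exact hff
  have hPs : star P = P := by
    rw [hPdef, ← cfc_star]
    refine cfc_congr fun w _ => ?_
    by_cases hw : w = 1 <;> simp [hf, hw]
  have hU : IsUnit (T - 1 + P) := by
    have : T - 1 + P = cfc (fun w => w - 1 + f w) T := by
      rw [cfc_add (a := T) (fun w => w - 1) f (by fun_prop) hfc,
        cfc_sub (fun w => w) (fun _ => 1) T, cfc_id' ℂ T, cfc_const_one ℂ T]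
    rw [this, isUnit_cfc_iff _ T (by fun_prop)]
    intro w _
    by_cases hw : w = 1
    · simp [hf, hw]
    · simp [hf, hw, sub_eq_zero]
  have hP0 : P ≠ 0 := by
    intro h0
    rw [h0, add_zero, IsUnit.sub_iff] at hU
    exact h1 (by simpa [resolventSet] using hU)
  obtain ⟨v, hv⟩ : ∃ v, P v ≠ 0 := by
    by_contra! h
    exact hP0 (ContinuousLinearMap.ext h)
  have hTPv : ∀ x, T (P x) = P x := fun x => congrArg (fun S : H →L[ℂ] H => S x) hTP
  obtain ⟨e, he⟩ : ∃ e, e = ((‖P v‖⁻¹ : ℝ) : ℂ) • P v := ⟨_, rfl⟩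
  have he1 : ‖e‖ = 1 := by
    rw [he, norm_smul]; simp [hv]
  have heT : T e = e := by rw [he, map_smul, hTPv]
  have hPe : P e = e := by
    obtain ⟨u, hu⟩ := hU.exists_left_inv
    have hz : (T - 1 + P) (e - P e) = 0 := by
      have : P (P e) = P e := by
        have h5 : P * P = P := by
          rw [hPdef, ← cfc_mul f f T hfc hfc]
          refine cfc_congr fun w _ => ?_
          by_cases hw : w = 1 <;> simp [hf, hw]
        exact congrArg (fun S : H →L[ℂ] H => S e) h5
      simp [heT, hTPv, this]
    have : (u * (T - 1 + P)) (e - P e) = 0 := by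
      rw [mul_apply_eq_comp, hz, map_zero]
    rw [hu, one_apply_eq_self, sub_eq_zero] at this
    exact this.symm
  have hin : ∀ x, inner ℂ e (P x) = inner ℂ e x := by
    intro x
    nth_rw 2 [← hPe]
    rw [← hPs, ContinuousLinearMap.star_eq_adjoint, ContinuousLinearMap.adjoint_inner_left,
      ← ContinuousLinearMap.star_eq_adjoint, hPs]
  refine ⟨e, he1, heT, fun x => ?_, ?_⟩
  · rw [← hin, ← hin x]
    congr 1
    exact congrArg (fun S : H →L[ℂ] H => S x) hPT
  · convert hU using 2
    ext x
    have he0 : e ≠ 0 := fun h => by simp [h] at he1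
    obtain ⟨a, ha⟩ := hS.exists_eq_smul heT he0 (hTPv x)
    rw [InnerProductSpace.rankOne_apply, ← hin x, ha, inner_smul_right,
      inner_self_eq_norm_sq_to_K, he1]
    simp
end

/-! ### Roots of unity -/

theorem isPrimitiveRoot_unityRoot_one {n : ℕ} (hn : 0 < n) : IsPrimitiveRoot (unityRoot n 1) n := by
  simpa [unityRoot] using Complex.isPrimitiveRoot_exp n hn.ne'

theorem unityRoot_eq_pow (n j : ℕ) : unityRoot n j = unityRoot n 1 ^ j := by
  rw [unityRoot, unityRoot, ← Complex.exp_nat_mul]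
  congr 1
  push_cast
  ring

theorem unityRoot_pow {n : ℕ} (hn : 0 < n) (j : ℕ) : unityRoot n j ^ n = 1 := by
  rw [unityRoot_eq_pow, ← pow_mul, mul_comm, pow_mul,
    (isPrimitiveRoot_unityRoot_one hn).pow_eq_one, one_pow]

theorem norm_unityRoot {n : ℕ} (hn : 0 < n) (j : ℕ) : ‖unityRoot n j‖ = 1 :=
  Complex.norm_eq_one_of_pow_eq_one (unityRoot_pow hn j) hn.ne'

theorem exists_unityRoot_mul_eq_one {n : ℕ} (hn : 0 < n) (m : ℕ) :
    ∃ j < n, unityRoot n j * unityRoot n m = 1 := by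
  have h : (unityRoot n m)⁻¹ ^ n = 1 := by rw [inv_pow, unityRoot_pow hn, inv_one]
  have : NeZero n := ⟨hn.ne'⟩
  obtain ⟨j, hj, hj'⟩ := (isPrimitiveRoot_unityRoot_one hn).eq_pow_of_pow_eq_one h
  refine ⟨j, hj, ?_⟩
  rw [unityRoot_eq_pow n j, hj', inv_mul_cancel₀]
  intro h0
  simpa [h0] using norm_unityRoot hn m

/-! ### From the Fourier surface to Bⁿe = e -/

section
variable {H : Type*} [NormedAddCommGroup H] [InnerProductSpace ℂ H]

theorem pencil_three (A B C : H →L[ℂ] H) (x y z : ℂ) :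
    pencil ![A, B, C] ![x, y, z] = x • A + y • B + z • C := by
  simp [pencil, Fin.sum_univ_three]

variable [CompleteSpace H]

/-- First-order perturbation of the Fourier surface along the line `z = -lam * y`, on which
the pencil factors. -/
theorem inner_apply_inverse_one_sub_smul {A B : H →L[ℂ] H} {n : ℕ} (hn : 0 < n) {ε : ℝ}
    {lam : ℂ} (hlam : lam ^ n = 1)
    (hsub : fourierSurface n ∩ polydisk ![lam, 0, 0] ε ⊆ properJointSpectrum ![A, B, A * B])
    {e : H} (he : ‖e‖ = 1) (hAe : (lam • A) e = e)
    (hAe' : ∀ v, inner ℂ e ((lam • A) v) = inner ℂ e v)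
    (hU : IsUnit (lam • A - 1 + InnerProductSpace.rankOne ℂ e e))
    {u : ℂ} (hu : ‖u‖ < ε) (huB : IsUnit (1 - u • B)) :
    inner ℂ e (B (Ring.inverse (1 - u • B) e)) =
      u ^ (n - 1) * inner ℂ e (Ring.inverse (1 - u • B) e) := by
  obtain ⟨V, hV⟩ : ∃ V, V = Ring.inverse (1 - u • B) := ⟨_, rfl⟩
  obtain ⟨T, hT⟩ : ∃ T, T = lam • A := ⟨_, rfl⟩
  rw [← hV]
  rw [← hT] at hAe hAe' hU
  have hlam1 : ‖lam‖ = 1 := Complex.norm_eq_one_of_pow_eq_one hlam hn.ne'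
  have hVl : V * (1 - u • B) = 1 := hV ▸ Ring.inverse_mul_cancel _ huB
  obtain ⟨g, hg⟩ : ∃ g : ℂ → ℂ, g = fun δ => 1 + u ^ n - (u + δ) ^ n := ⟨_, rfl⟩
  have hg0 : g 0 = 1 := by simp [hg]
  have hgd : HasDerivAt g (-(n * u ^ (n - 1))) 0 := by
    have := (((hasDerivAt_id (0 : ℂ)).const_add u).fun_pow n).const_sub (1 + u ^ n)
    simpa [hg] using this
  -- The point (`lam * (1 + s δ)`, `u + δ`, `-lam * u`) lies on the surface exactly when (1 + s)ⁿ =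
  -- `g δ`; the principal root is the branch with s(0) = 0.
  obtain ⟨s, hs⟩ : ∃ s : ℂ → ℂ, s = fun δ => g δ ^ ((n : ℂ)⁻¹) - 1 := ⟨_, rfl⟩
  have hn0 : (n : ℂ) ≠ 0 := by exact_mod_cast hn.ne'
  have hs0 : s 0 = 0 := by simp [hs, hg0]
  have hsd : HasDerivAt s (-u ^ (n - 1)) 0 := by
    have := (hgd.cpow_const (c := (n : ℂ)⁻¹)
      (by rw [hg0]; exact Complex.one_mem_slitPlane)).sub_const 1
    rw [hg0, Complex.one_cpow] at this
    rw [hs]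
    rwa [mul_one, mul_neg, ← mul_assoc, inv_mul_cancel₀ hn0, one_mul] at this
  have hsn : ∀ δ, (1 + s δ) ^ n = g δ := by
    intro δ
    simp only [hs, add_sub_cancel]
    exact Complex.cpow_nat_inv_pow _ hn.ne'
  have hEd : HasDerivAt (fun δ => (s δ • T + δ • B) * V) ((-u ^ (n - 1) • T + B) * V) 0 := by
    have := ((hsd.smul_const T).add ((hasDerivAt_id (0 : ℂ)).smul_const B)).mul_const V
    simpa using this
  by_contra hne
  obtain ⟨P, hP⟩ : ∃ P, P = InnerProductSpace.rankOne ℂ e e := ⟨_, rfl⟩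
  have hPapp : ∀ v, P v = (inner ℂ e v : ℂ) • e := fun v => by rw [hP]; simp
  have hee : inner ℂ e e = (1 : ℂ) := by simp [inner_self_eq_norm_sq_to_K, he]
  rw [← hP] at hU
  have hev := eventually_isUnit_add_of_hasDerivAt (K := T - 1) (P := P)
    (c := inner ℂ e (B (V e)) - u ^ (n - 1) * inner ℂ e (V e))
    (by ext v; simp only [mul_apply_eq_comp, hPapp, inner_smul_right, hee, mul_one])
    (by ext v; simp [hPapp, hAe'])
    (by ext v; simp [hPapp, hAe])
    hU
    (by
      ext v
      simp [hPapp, inner_smul_right, hAe', smul_smul]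
      ring_nf)
    (sub_ne_zero.2 hne) hEd (by simp [hs0])
  have hc1 : ∀ᶠ δ in 𝓝 (0 : ℂ), ‖lam * (1 + s δ) - lam‖ < ε := by
    have : ContinuousAt (fun δ => ‖lam * (1 + s δ) - lam‖) 0 := by
      have := hsd.continuousAt
      fun_prop
    refine this.eventually_lt_const ?_
    simpa [hs0] using (norm_nonneg u).trans_lt hu
  have hc2 : ∀ᶠ δ in 𝓝 (0 : ℂ), ‖u + δ‖ < ε := by
    have : ContinuousAt (fun δ => ‖u + δ‖) 0 := by fun_prop
    refine this.eventually_lt_const ?_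
    simpa using hu
  obtain ⟨δ, h1, h2, h3⟩ :=
    (hev.and ((hc1.and hc2).filter_mono nhdsWithin_le_nhds)).exists
  have hmem : ![lam * (1 + s δ), u + δ, -lam * u] ∈ properJointSpectrum ![A, B, A * B] := by
    refine hsub ⟨?_, ?_⟩
    · have hsgn : (-1 : ℂ) ^ (n - 1) * (-1) ^ n = -1 := by
        rw [← pow_add, show n - 1 + n = 2 * (n - 1) + 1 by omega, pow_succ, pow_mul]
        simp
      have : (-1 : ℂ) ^ (n - 1) * (-lam * u) ^ n = -u ^ n := by
        rw [neg_mul, neg_pow (lam * u), mul_pow, hlam, ← mul_assoc, hsgn]; ring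
      simp only [fourierSurface, Set.mem_ofPred_eq, Matrix.cons_val]
      rw [this, mul_pow, hlam, hsn, hg]
      ring
    · intro j
      fin_cases j
      · simpa using h2
      · simpa using h3
      · simpa [hlam1] using hu
  apply hmem
  have : pencil ![A, B, A * B] ![lam * (1 + s δ), u + δ, -lam * u] - 1 =
      (T - 1 + (s δ • T + δ • B) * V) * (1 - u • B) := by
    rw [pencil_three, add_mul, mul_assoc _ V, hVl, hT]
    simp only [sub_mul, mul_sub, mul_one, one_mul, smul_mul_assoc, mul_smul_comm, smul_smul]
    module
  rw [this]
  exact h1.mul huB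

/-- With φₘ(u) = ⟨e, Bᵐ(1 - uB)⁻¹e⟩ one has φₘ(u) = ⟨e, Bᵐe⟩ + uφₘ₊₁(u). Repeatedly letting u → 0
and dividing by u turns φ₁ = uⁿ⁻¹φ₀ into φₙ = φ₀, whose value at 0 is 1. -/
theorem pow_apply_eq_self_of_inner_inverse {B : H →L[ℂ] H} (hB : ‖B‖ ≤ 1) {n : ℕ} (hn : 0 < n)
    {e : H} (he : ‖e‖ = 1)
    (h : ∀ᶠ u in 𝓝 (0 : ℂ), inner ℂ e (B (Ring.inverse (1 - u • B : H →L[ℂ] H) e)) =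
      u ^ (n - 1) * inner ℂ e (Ring.inverse (1 - u • B : H →L[ℂ] H) e)) :
    (B ^ n) e = e := by
  obtain ⟨φ, hφ⟩ : ∃ φ : ℕ → ℂ → ℂ,
    φ = fun m u => inner ℂ e ((B ^ m) (Ring.inverse (1 - u • B : H →L[ℂ] H) e)) := ⟨_, rfl⟩
  have hcB : ContinuousAt (fun u : ℂ => 1 - u • B) 0 := by fun_prop
  have hcont : ∀ m, ContinuousAt (φ m) 0 := by
    intro m
    have h1 : ContinuousAt (fun u : ℂ => Ring.inverse (1 - u • B)) 0 := by
      refine ContinuousAt.comp (g := Ring.inverse) ?_ hcB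
      simpa using NormedRing.inverse_continuousAt (1 : (H →L[ℂ] H)ˣ)
    rw [hφ]
    fun_prop
  have hunit : ∀ᶠ u in 𝓝 (0 : ℂ), IsUnit (1 - u • B) :=
    hcB.eventually (Units.isOpen.mem_nhds (by simp))
  have hzero : ∀ m, φ m 0 = inner ℂ e ((B ^ m) e) := by intro m; simp [hφ]
  have hstep : ∀ m u, IsUnit (1 - u • B) → φ m u = inner ℂ e ((B ^ m) e) + u * φ (m + 1) u := by
    intro m u hu
    have h1 : B ^ m * Ring.inverse (1 - u • B) =
        B ^ m + u • (B ^ (m + 1) * Ring.inverse (1 - u • B)) := by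
      have := Ring.mul_inverse_cancel _ hu
      calc _ = B ^ m * ((1 - u • B) * Ring.inverse (1 - u • B)) +
            u • (B ^ (m + 1) * Ring.inverse (1 - u • B)) := by
            rw [sub_mul, one_mul, mul_sub, smul_mul_assoc, mul_smul_comm, pow_succ, mul_assoc,
              sub_add_cancel]
        _ = _ := by rw [this, mul_one]
    have h2 := congrArg (fun S : H →L[ℂ] H => inner ℂ e (S e)) h1
    simpa [hφ, inner_add_right, inner_smul_right] using h2
  have hlim : ∀ m a, (∀ᶠ u in 𝓝[≠] (0 : ℂ), φ m u = u ^ a * φ 0 u) →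
      inner ℂ e ((B ^ m) e) = 0 ^ a * (1 : ℂ) := by
    intro m a hm
    have h1 : Tendsto (φ m) (𝓝[≠] 0) (𝓝 (inner ℂ e ((B ^ m) e))) :=
      hzero m ▸ (hcont m).tendsto.mono_left nhdsWithin_le_nhds
    have h2 : Tendsto (fun u : ℂ => u ^ a * φ 0 u) (𝓝[≠] 0) (𝓝 (0 ^ a * 1)) := by
      have h3 : ContinuousAt (fun u : ℂ => u ^ a * φ 0 u) 0 := by
        have := hcont 0
        fun_prop
      have h4 : φ 0 0 = 1 := by rw [hzero]; simp [inner_self_eq_norm_sq_to_K, he]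
      rw [← h4]
      exact h3.tendsto.mono_left nhdsWithin_le_nhds
    exact tendsto_nhds_unique (h1.congr' hm) h2
  have hind : ∀ k, k < n → ∀ᶠ u in 𝓝[≠] (0 : ℂ), φ (k + 1) u = u ^ (n - (k + 1)) * φ 0 u := by
    intro k
    induction k with
    | zero =>
      intro _
      filter_upwards [h.filter_mono nhdsWithin_le_nhds] with u hu
      simpa [hφ] using hu
    | succ k ih =>
      intro hk
      have ih := ih (by omega)
      have hz := hlim _ _ ih
      rw [zero_pow (by omega), zero_mul] at hz
      filter_upwards [ih, hunit.filter_mono nhdsWithin_le_nhds, self_mem_nhdsWithin]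
        with u h1 h2 (h3 : u ≠ 0)
      rw [hstep _ _ h2, hz, zero_add, show n - (k + 1) = n - (k + 1 + 1) + 1 by omega,
        pow_succ', mul_assoc] at h1
      exact mul_left_cancel₀ h3 h1
  obtain ⟨k, rfl⟩ : ∃ k, n = k + 1 := ⟨n - 1, by omega⟩
  have hfin := hlim _ _ (hind k (by omega))
  rw [Nat.sub_self, pow_zero, one_mul] at hfin
  have hle : ‖(B ^ (k + 1)) e‖ ≤ 1 := by
    refine ((B ^ (k + 1)).le_opNorm e).trans ?_
    rw [he, mul_one]
    exact (norm_pow_le' B k.succ_pos).trans (pow_le_one₀ (norm_nonneg B) hB)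
  -- Equality case of Cauchy–Schwarz: ‖Bⁿe - e‖² = ‖Bⁿe‖² - 2 + 1 ≤ 0.
  rw [← sub_eq_zero, ← norm_eq_zero, ← sq_eq_zero_iff]
  have := norm_sub_sq (𝕜 := ℂ) ((B ^ (k + 1)) e) e
  rw [← inner_conj_symm, hfin, he] at this
  simp only [map_one, RCLike.one_re, mul_one, one_pow] at this
  nlinarith [norm_nonneg ((B ^ (k + 1)) e), sq_nonneg ‖(B ^ (k + 1)) e - e‖]

end

/-! ### Discrete Fourier decomposition -/

/-- A vector fixed by `Sⁿ` is a sum of eigenvectors of `S` for the `n`-th roots of unity. -/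
theorem mem_of_pow_apply_eq_self {V : Type*} [AddCommGroup V] [Module ℂ V] {S : Module.End ℂ V}
    {n : ℕ} (hn : 0 < n) {M : Submodule ℂ V}
    (hM : ∀ k < n, ∀ w, unityRoot n k • S w = w → w ∈ M) {v : V} (hv : (S ^ n) v = v) : v ∈ M := by
  have hω := isPrimitiveRoot_unityRoot_one hn
  -- The k-th Fourier average of the orbit of `v` is fixed by `unityRoot n k • S`; the averages sum
  -- to `n • v`.
  have hmem : ∀ k ∈ Finset.range n, ∑ l ∈ Finset.range n, unityRoot n k ^ l • (S ^ l) v ∈ M := by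
    intro k hk
    refine hM k (Finset.mem_range.1 hk) _ ?_
    have h1 : unityRoot n k • S (∑ l ∈ Finset.range n, unityRoot n k ^ l • (S ^ l) v) =
        ∑ l ∈ Finset.range n, unityRoot n k ^ (l + 1) • (S ^ (l + 1)) v := by
      rw [map_sum, Finset.smul_sum]
      refine Finset.sum_congr rfl fun l _ => ?_
      rw [map_smul, smul_smul, pow_succ' _ l, pow_succ' S l, Module.End.mul_apply]
    rw [h1]
    have h2 := Finset.sum_range_succ (fun l => unityRoot n k ^ l • (S ^ l) v) n
    rw [Finset.sum_range_succ', hv, unityRoot_pow hn] at h2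
    simpa using h2
  have hsum : ∑ k ∈ Finset.range n, ∑ l ∈ Finset.range n, unityRoot n k ^ l • (S ^ l) v =
      (n : ℂ) • v := by
    rw [Finset.sum_comm, Finset.sum_eq_single 0]
    · simp [Nat.cast_smul_eq_nsmul]
    · intro l hl hl0
      rw [← Finset.sum_smul]
      have h1 : unityRoot n 1 ^ l ≠ 1 :=
        hω.pow_ne_one_of_pos_of_lt hl0 (Finset.mem_range.1 hl)
      have h2 := geom_sum_mul (unityRoot n 1 ^ l) n
      rw [← pow_mul, mul_comm l, pow_mul, hω.pow_eq_one, one_pow, sub_self] at h2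
      have h3 := (mul_eq_zero.1 h2).resolve_right (sub_ne_zero.2 h1)
      have h4 : ∑ k ∈ Finset.range n, unityRoot n k ^ l = 0 := by
        rw [← h3]
        refine Finset.sum_congr rfl fun k _ => ?_
        rw [unityRoot_eq_pow n k, ← pow_mul, ← pow_mul, mul_comm]
      rw [h4, zero_smul]
    · intro h; exact absurd (Finset.mem_range.2 hn) h
  have hn0 : (n : ℂ) ≠ 0 := by exact_mod_cast hn.ne'
  have := M.smul_mem (n : ℂ)⁻¹ (hsum ▸ M.sum_mem hmem)
  rwa [smul_smul, inv_mul_cancel₀ hn0, one_smul] at this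

/-! ### Contractions and unitary restrictions -/

section
variable {H : Type*} [NormedAddCommGroup H] [InnerProductSpace ℂ H] [CompleteSpace H]

/-- Unlike norm preservation, the conclusion is linear in `f`, so it passes from spanning vectors to
their span. -/
theorem adjoint_apply_apply_of_norm_eq {S : H →L[ℂ] H} (hS : ‖S‖ ≤ 1) {f : H}
    (hf : ‖S f‖ = ‖f‖) : ContinuousLinearMap.adjoint S (S f) = f := by
  have h1 : ‖ContinuousLinearMap.adjoint S (S f)‖ ≤ ‖f‖ := by
    refine ((ContinuousLinearMap.adjoint S).le_opNorm _).trans ?_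
    rw [LinearIsometryEquiv.norm_map, hf]
    exact mul_le_of_le_one_left (norm_nonneg _) hS
  have h2 := norm_sub_sq (𝕜 := ℂ) (ContinuousLinearMap.adjoint S (S f)) f
  rw [ContinuousLinearMap.adjoint_inner_left, inner_self_eq_norm_sq, hf] at h2
  rw [← sub_eq_zero, ← norm_eq_zero, ← sq_eq_zero_iff]
  nlinarith [norm_nonneg (ContinuousLinearMap.adjoint S (S f)),
    sq_nonneg ‖ContinuousLinearMap.adjoint S (S f) - f‖]

theorem restrictsToUnitary_of_adjoint_apply_apply {S : H →L[ℂ] H} {L : Submodule ℂ H}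
    [FiniteDimensional ℂ L] (hL : ∀ v ∈ L, S v ∈ L)
    (hS : ∀ v ∈ L, ContinuousLinearMap.adjoint S (S v) = v) : RestrictsToUnitary S L := by
  let U : L →ₗᵢ[ℂ] L := ⟨(S : H →ₗ[ℂ] H).restrict hL, fun v => by
    have h : ‖S v‖ ^ 2 = ‖(v : H)‖ ^ 2 := by
      rw [← inner_self_eq_norm_sq (𝕜 := ℂ), ← ContinuousLinearMap.adjoint_inner_left,
        hS v v.2, inner_self_eq_norm_sq]
    exact (sq_eq_sq₀ (norm_nonneg _) (norm_nonneg _)).1 h⟩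
  exact ⟨U.toLinearIsometryEquiv rfl, fun v => rfl⟩

theorem restrictsToUnitary_span {S : H →L[ℂ] H} {n : ℕ} {f : Fin n → H}
    (hf : ∀ k, S (f k) ∈ Submodule.span ℂ (Set.range f))
    (hS : ∀ k, ContinuousLinearMap.adjoint S (S (f k)) = f k) :
    (∀ v ∈ Submodule.span ℂ (Set.range f), S v ∈ Submodule.span ℂ (Set.range f)) ∧
      RestrictsToUnitary S (Submodule.span ℂ (Set.range f)) := by
  have h1 : ∀ v ∈ Submodule.span ℂ (Set.range f), S v ∈ Submodule.span ℂ (Set.range f) := by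
    intro v hv
    induction hv using Submodule.span_induction with
    | mem x hx => obtain ⟨k, rfl⟩ := hx; exact hf k
    | zero => simp
    | add x y _ _ hx hy => rw [map_add]; exact add_mem hx hy
    | smul a x _ hx => rw [map_smul]; exact Submodule.smul_mem _ _ hx
  have : FiniteDimensional ℂ (Submodule.span ℂ (Set.range f)) :=
    FiniteDimensional.span_of_finite ℂ (Set.finite_range f)
  refine ⟨h1, restrictsToUnitary_of_adjoint_apply_apply h1 fun v hv => ?_⟩
  induction hv using Submodule.span_induction with
  | mem x hx => obtain ⟨k, rfl⟩ := hx; exact hS k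
  | zero => simp
  | add x y _ _ hx hy => rw [map_add, map_add, hx, hy]
  | smul a x _ hx => rw [map_smul, map_smul, hx]
end

/-! ### Comparing the eigenvectors of A and B -/

theorem mainTheorem1 {H : Type*} [NormedAddCommGroup H] [InnerProductSpace ℂ H]
    [CompleteSpace H] (A B : H →L[ℂ] H) (hA : IsStarNormal A) (hB : ‖B‖ = 1)
    (n : ℕ) (hn : 0 < n) (ε : ℝ) (hε : 0 < ε)
    (hspec : ∀ j < n, ∀ τ : Fin 3 → ℂ,
      (τ = ![unityRoot n j, 0, 0] ∨ τ = ![0, unityRoot n j, 0]) →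
        properJointSpectrum ![A, B, A * B] ∩ polydisk τ ε = fourierSurface n ∩ polydisk τ ε)
    (hmult : ∀ j < n, ∀ τ : Fin 3 → ℂ,
      (τ = ![unityRoot n j, 0, 0] ∨ τ = ![0, unityRoot n j, 0]) →
        ∀ x ∈ properJointSpectrum ![A, B, A * B] ∩ polydisk τ ε,
          HasMultiplicityAt ![A, B, A * B] x 1) :
    Module.finrank ℂ (rootEigenspan A n) = n ∧
      (∀ v ∈ rootEigenspan A n, B v ∈ rootEigenspan A n) ∧
      RestrictsToUnitary B (rootEigenspan A n) ∧
      RestrictsToUnitary A (rootEigenspan A n) := by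
  have hcenter : ∀ τ : Fin 3 → ℂ, τ ∈ polydisk τ ε := fun τ i => by simpa using hε
  have hmultA : ∀ j < n, IsIsolatedSpectralPointOfMultiplicity (unityRoot n j • A) 1 1 := by
    intro j hj
    have h := hmult j hj _ (Or.inl rfl) ![unityRoot n j, 0, 0]
      ((hspec j hj _ (Or.inl rfl)).ge
        ⟨by simp [fourierSurface, unityRoot_pow hn, hn.ne'], hcenter _⟩)
    simpa [HasMultiplicityAt, pencil_three] using h
  have hmultB : ∀ j < n, IsIsolatedSpectralPointOfMultiplicity (unityRoot n j • B) 1 1 := by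
    intro j hj
    have h := hmult j hj _ (Or.inr rfl) ![0, unityRoot n j, 0]
      ((hspec j hj _ (Or.inr rfl)).ge
        ⟨by simp [fourierSurface, unityRoot_pow hn, hn.ne'], hcenter _⟩)
    simpa [HasMultiplicityAt, pencil_three] using h
  have hne : ∀ j, unityRoot n j ≠ 0 := fun j h0 => by simpa [h0] using norm_unityRoot hn j
  have hexA : ∀ m : Fin n, ∃ e : H, ‖e‖ = 1 ∧ A e = unityRoot n m • e ∧
      (∀ w, A w = unityRoot n m • w → ∃ a : ℂ, w = a • e) ∧
      ContinuousLinearMap.adjoint A (A e) = e ∧ (B ^ n) e = e := by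
    intro m
    obtain ⟨j, hj, hjm⟩ := exists_unityRoot_mul_eq_one hn m
    have hN : IsStarNormal (unityRoot n j • A) := inferInstance
    obtain ⟨e, he, hAe, hAe', hU⟩ := exists_eigenvector_of_isStarNormal hN (hmultA j hj)
    have hiff : ∀ w, (unityRoot n j • A) w = w ↔ A w = unityRoot n m • w := by
      intro w
      rw [smul_apply]
      constructor
      · intro h
        conv_rhs => rw [← h]
        rw [smul_smul, mul_comm, hjm, one_smul]
      · intro h
        rw [h, smul_smul, hjm, one_smul]
    have he0 : e ≠ 0 := fun h => by simp [h] at he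
    refine ⟨e, he, (hiff e).1 hAe, fun w hw =>
      (hmultA j hj).exists_eq_smul hAe he0 ((hiff w).2 hw), ?_, ?_⟩
    · refine ext_inner_right ℂ fun v => ?_
      have h1 : (starRingEnd ℂ) (unityRoot n j) * unityRoot n j = 1 := by
        rw [Complex.conj_mul', norm_unityRoot hn]; simp
      have h2 := hAe' v
      rw [← hAe, smul_apply, smul_apply, inner_smul_left, inner_smul_right, ← mul_assoc, h1,
        one_mul] at h2
      rw [ContinuousLinearMap.adjoint_inner_left, h2, ← smul_apply, hAe]
    · refine pow_apply_eq_self_of_inner_inverse hB.le hn he ?_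
      have hcB : ContinuousAt (fun u : ℂ => 1 - u • B) 0 := by fun_prop
      have hunit : ∀ᶠ u in 𝓝 (0 : ℂ), IsUnit (1 - u • B) :=
        hcB.eventually (Units.isOpen.mem_nhds (by simp))
      filter_upwards [hunit, Metric.ball_mem_nhds 0 hε] with u hu hu'
      exact inner_apply_inverse_one_sub_smul hn (unityRoot_pow hn j)
        ((hspec j hj _ (Or.inl rfl)).ge.trans Set.inter_subset_left) he hAe hAe' hU
        (by simpa using hu') hu
  choose e he hAe hAuniq hAiso hBe using hexA
  have hexB : ∀ k : Fin n, ∃ f : H, unityRoot n k • B f = f ∧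
      ∀ w, unityRoot n k • B w = w → ∃ a : ℂ, w = a • f := by
    intro k
    by_cases h : ∃ f, f ≠ 0 ∧ unityRoot n k • B f = f
    · obtain ⟨f, hf0, hf⟩ := h
      exact ⟨f, hf, fun w hw => (hmultB k k.2).exists_eq_smul hf hf0 hw⟩
    · push Not at h
      -- A missing eigenvector is replaced by 0; the dimension count later needs only the bound n on
      -- the span of `f`.
      refine ⟨0, by simp, fun w hw => ⟨0, ?_⟩⟩
      by_contra hw0
      exact h w (by simpa using hw0) hw
  choose f hBf hBuniq using hexB
  have hL : rootEigenspan A n = Submodule.span ℂ (Set.range e) := by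
    apply le_antisymm
    · refine Submodule.span_le.2 ?_
      rintro v ⟨m, hm, hv⟩
      obtain ⟨a, rfl⟩ := hAuniq ⟨m, hm⟩ v hv.apply_eq_smul
      exact Submodule.smul_mem _ _ (Submodule.subset_span ⟨_, rfl⟩)
    · refine Submodule.span_le.2 ?_
      rintro _ ⟨m, rfl⟩
      refine Submodule.subset_span ⟨m, m.2, Module.End.hasEigenvector_iff.2 ⟨?_, ?_⟩⟩
      · exact Module.End.mem_eigenspace_iff.2 (hAe m)
      · intro h; simpa [h] using he m
  have hli : LinearIndependent ℂ e := by
    refine Module.End.eigenvectors_linearIndependent' (A : Module.End ℂ H)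
      (fun m : Fin n => unityRoot n m) ?_ e fun m => Module.End.hasEigenvector_iff.2
        ⟨Module.End.mem_eigenspace_iff.2 (hAe m), fun h => by simpa [h] using he m⟩
    intro a b hab
    simp only [unityRoot_eq_pow n a, unityRoot_eq_pow n b] at hab
    exact Fin.ext ((isPrimitiveRoot_unityRoot_one hn).pow_inj a.2 b.2 hab)
  have hdim : Module.finrank ℂ (Submodule.span ℂ (Set.range e)) = n := by
    rw [finrank_span_eq_card hli, Fintype.card_fin]
  have hLM : Submodule.span ℂ (Set.range e) = Submodule.span ℂ (Set.range f) := by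
    have : FiniteDimensional ℂ (Submodule.span ℂ (Set.range f)) :=
      FiniteDimensional.span_of_finite ℂ (Set.finite_range f)
    refine Submodule.eq_of_le_of_finrank_le (Submodule.span_le.2 ?_) ?_
    · rintro _ ⟨m, rfl⟩
      refine mem_of_pow_apply_eq_self (S := (B : Module.End ℂ H)) hn (fun k hk w hw => ?_) ?_
      · obtain ⟨a, rfl⟩ := hBuniq ⟨k, hk⟩ w hw
        exact Submodule.smul_mem _ _ (Submodule.subset_span ⟨_, rfl⟩)
      · simpa [Module.End.pow_apply] using hBe m
    · rw [hdim]
      exact (finrank_range_le_card f).trans_eq (Fintype.card_fin n)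
  have hA' := restrictsToUnitary_span (S := A) (f := e)
    (fun k => hAe k ▸ Submodule.smul_mem _ _ (Submodule.subset_span ⟨k, rfl⟩)) hAiso
  have hB' := restrictsToUnitary_span (S := B) (f := f)
    (fun k => by
      have h : f k ∈ Submodule.span ℂ (Set.range f) := Submodule.subset_span ⟨k, rfl⟩
      rw [← hBf k] at h
      exact (Submodule.smul_mem_iff _ (hne k)).1 h)
    (fun k => adjoint_apply_apply_of_norm_eq hB.le (by
      have h := congrArg norm (hBf k)
      rwa [norm_smul, norm_unityRoot hn, one_mul] at h))
  rw [hL]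
  exact ⟨hdim, hLM ▸ hB'.1, hLM ▸ hB'.2, hA'.2⟩
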